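/- Conventions. A representation of a set $X$ is a surjective partial map $\delta_X:\subseteq\mathbb N^{\mathbb N}\to X$; if $\delta_X(p)=x$, then $p$ is called a name of $x$. A problem $f:\subseteq X\rightrightarrows Y$ is a partial multi-valued map between represented spaces, with $\mathrm{dom}(f)=\{x\in X:f(x)\neq\emptyset\}$. A partial function $F:\subseteq\mathbb N^{\mathbb N}\to\mathbb N^{\mathbb N}$ is a realizer of $f$ (written $F\vdash f$) if $\delta_Y(F(p))\in f(\delta_X(p))$ (in particular, both sides are defined) for all names $p$ of points of $\mathrm{dom}(f)$. For problems $f,g$ we write $f\leq_{\mathrm W}g$ (Weihrauch reducibility) if there are computable $H,K:\subseteq\mathbb N^{\mathbb N}\to\mathbb N^{\mathbb N}$ such that $H\langle\mathrm{id},GK\rangle\vdash f$ for all $G\vdash g$, and $f<_{\mathrm W}g$ if $f\leq_{\mathrm W}g$ and $g\not\leq_{\mathrm W}f$. Completion. For $p\in\mathbb N^{\mathbb N}$ let $p-1$ be the finite or infinite sequence obtained from $p$ by deleting all zeros and decreasing all other entries by one. The completion of a represented space $X$ is $\overline X=X\cup\{\bot\}$ with $\bot\notin X$, represented by $\delta_{\overline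 X}(p)=\delta_X(p-1)$ if $p-1$ is infinite and in $\mathrm{dom}(\delta_X)$, and $\delta_{\overline X}(p)=\bot$ otherwise. The completion of a problem $f:\subseteq X\rightrightarrows Y$ is the problem $\overline f:\overline X\rightrightarrows\overline Y$ with $\overline f(x)=f(x)$ if $x\in\mathrm{dom}(f)$ and $\overline f(x)=\overline Y$ otherwise. Choice. Let $X$ be $[0,1]$ with the Euclidean metric, Lebesgue measure and a standard enumeration $\alpha$ of the rational numbers in $[0,1]$, or $2^{\mathbb N}$ with the metric $d(x,y)=2^{-\min\{n:x(n)\neq y(n)\}}$ for $x\neq y$, the uniform measure and a standard enumeration $\alpha$ of the eventually zero sequences. The space $X$ carries the Cauchy representation: $p$ is a name of $x$ if $d(\alpha(p(i)),\alpha(p(j)))\leq 2^{-i}$ for all $i<j$ and $\lim_{n\to\infty}\alpha(p(n))=x$. The set $\mathcal A_-(X)$ of closed subsets of $X$ is represented by negative information: $p$ is a name of $X\setminus\bigcup_{n\in\mathbb N}B_{p(n)}$, where $B_{\langle n,\langle i,k\rangle\rangle}$ is the open ball with center $\alpha(n)$ and radius $\frac{i}{k+1}$. Positive choice $\mathsf{PC}_X:\subseteq\mathcal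 A_-(X)\rightrightarrows X,\ A\mapsto A$ is defined exactly for the closed sets $A$ of positive measure, and positive connected choice $\mathsf{PCC}_X$ is its restriction to the connected closed sets of positive measure. Proposition. $\overline{\mathsf{PCC}_{[0,1]}}\not\leq_{\mathrm W}\mathsf{PC}_{[0,1]}$, i.e. the completion of positive connected choice on $[0,1]$ is not Weihrauch reducible to positive choice on $[0,1]$. Moreover, $\mathsf{PC}_{2^{\mathbb N}}<_{\mathrm W}\overline{\mathsf{PC}_{2^{\mathbb N}}}$ and $\mathsf{PCC}_{[0,1]}<_{\mathrm W}\overline{\mathsf{PCC}_{[0,1]}}$. -/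

import Mathlib

namespace WeihrauchChoice

/-! ### Computable partial functions on Baire space -/

/-- Baire space `ℕ^ℕ`. -/
abbrev Baire : Type := ℕ → ℕ

/-- The finite prefix `p(0) p(1) ... p(n-1)` of `p`. -/
def prefixWord (p : Baire) (n : ℕ) : List ℕ := (List.range n).map p

/-- Computability of a partial function `F` on Baire space: there is a computable prefix-monotone
word function `φ` that approximates `F`, that is, for every `p` in the domain of `F` the words
`φ (p(0) ... p(m-1))` are prefixes of `F p` of unbounded length.  Equivalently, some oracle
machine (Type-2 machine) computes `F p` from `p` for every `p` in the domain of `F`. -/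
def IsComputable (F : Baire →. Baire) : Prop :=
  ∃ φ : List ℕ → List ℕ, Computable φ ∧ (∀ u v, u <+: v → φ u <+: φ v) ∧
    ∀ p, ∀ q ∈ F p,
      (∀ m, φ (prefixWord p m) = prefixWord q (φ (prefixWord p m)).length) ∧
      ∀ n, ∃ m, n ≤ (φ (prefixWord p m)).length

/-- The pairing `⟨p, q⟩` on Baire space, `⟨p, q⟩(2n) = p(n)` and `⟨p, q⟩(2n+1) = q(n)`. -/
def pairing (p q : Baire) : Baire := fun n => if n % 2 = 0 then p (n / 2) else q (n / 2)

/-! ### Represented spaces and problems -/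

/-- A representation of `X`, i.e. a surjective partial map `δ` from Baire space to `X`, given by
its graph: `names p x` says that `δ(p)` is defined and equal to `x`. -/
structure Representation (X : Type*) where
  names : Baire → X → Prop
  unique : ∀ p x y, names p x → names p y → x = y
  surjective : ∀ x, ∃ p, names p x

/-- A problem, i.e. a partial multi-valued map between represented spaces `X` and `Y`.  The set of
possible values at `x` is `val x`, and the domain consists of the `x` with `val x ≠ ∅`. -/
structure Problem (X Y : Type*) where
  inRep : Representation X
  outRep : Representation Y
  val : X → Set Y

/-- The domain of a problem. -/
def Problem.dom {X Y : Type*} (f : Problem X Y) : Set X := {x | (f.val x).Nonempty}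

/-- `Realizes F f` says that the partial function `F` is a realizer of `f`: for every name `p` of
a point `x` in the domain of `f`, the value `F p` exists and is a name of a point of `f x`. -/
def Realizes {X Y : Type*} (F : Baire →. Baire) (f : Problem X Y) : Prop :=
  ∀ p x, f.inRep.names p x → x ∈ f.dom → ∃ q ∈ F p, ∃ y ∈ f.val x, f.outRep.names q y

/-- The partial function `H ⟨id, G K⟩`. -/
def sandwich (H G K : Baire →. Baire) : Baire →. Baire :=
  fun p => (K p).bind fun k => (G k).bind fun q => H (pairing p q)

/-- Weihrauch reducibility. -/
def WeihrauchLE {X Y U V : Type*} (f : Problem X Y) (g : Problem U V) : Prop :=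
  ∃ H K : Baire →. Baire, IsComputable H ∧ IsComputable K ∧
    ∀ G : Baire →. Baire, Realizes G g → Realizes (sandwich H G K) f

/-- Strict Weihrauch reducibility. -/
def WeihrauchLT {X Y U V : Type*} (f : Problem X Y) (g : Problem U V) : Prop :=
  WeihrauchLE f g ∧ ¬ WeihrauchLE g f

/-! ### Completion -/

/-- The sequence `p - 1`, obtained from `p` by deleting all zeros and decreasing the remaining
entries by one; only used if `p` has infinitely many nonzero entries. -/
noncomputable def decrement (p : Baire) : Baire :=
  fun n => p (Nat.nth (fun i => p i ≠ 0) n) - 1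

/-- `p` is a name of `x` in the precompletion of `δ`: the sequence `p - 1` is infinite and is a
`δ`-name of `x`. -/
def Representation.precompletionNames {X : Type*} (δ : Representation X) (p : Baire) (x : X) :
    Prop :=
  {i | p i ≠ 0}.Infinite ∧ δ.names (decrement p) x

theorem decrement_succ (q : Baire) : decrement (fun n => q n + 1) = q := by
  funext n
  have h : (fun i => (fun n => q n + 1) i ≠ 0) = fun _ : ℕ => True := by
    funext i; simp
  simp only [decrement, h, Nat.nth_true, Nat.add_sub_cancel]

/-- The completion of a represented space `X` is `X ∪ {⊥}`, here `Option X` with `none` as `⊥`;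
a sequence names `x ∈ X` if it does so in the precompletion, and it names `⊥` otherwise. -/
def Representation.completion {X : Type*} (δ : Representation X) : Representation (Option X) where
  names p x :=
    match x with
    | some x => δ.precompletionNames p x
    | none => ¬ ∃ x, δ.precompletionNames p x
  unique p x y hx hy := by
    cases x with
    | none =>
      cases y with
      | none => rfl
      | some y => exact (hx ⟨y, hy⟩).elim
    | some x =>
      cases y with
      | none => exact (hy ⟨x, hx⟩).elim
      | some y => exact congrArg some (δ.unique _ x y hx.2 hy.2)
  surjective x := by
    cases x with
    | none =>
      refine ⟨fun _ => 0, ?_⟩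
      rintro ⟨x, hx, -⟩
      simp at hx
    | some x =>
      obtain ⟨q, hq⟩ := δ.surjective x
      refine ⟨fun n => q n + 1, ?_, ?_⟩
      · simpa using Set.infinite_univ (α := ℕ)
      · rw [decrement_succ]; exact hq

/-- The completion of a problem: it agrees with `f` on the domain of `f`, and all points of the
completed output space are admitted as values elsewhere. -/
def Problem.completion {X Y : Type*} (f : Problem X Y) : Problem (Option X) (Option Y) where
  inRep := f.inRep.completion
  outRep := f.outRep.completion
  val x := {y | ∀ x', x = some x' → x' ∈ f.dom → ∃ y' ∈ f.val x', y = some y'}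

/-! ### Metric spaces with a dense sequence and their closed subsets -/

section Metric

variable {X : Type*} [MetricSpace X]

/-- The Cauchy representation of a metric space with dense sequence `α`: `p` is a name of `x` if
the sequence `α(p(0)), α(p(1)), ...` converges rapidly to `x`. -/
def cauchyRep (α : ℕ → X) (hα : DenseRange α) : Representation X where
  names p x := (∀ i j, i < j → dist (α (p i)) (α (p j)) ≤ (1 / 2 : ℝ) ^ i) ∧
    Filter.Tendsto (fun n => α (p n)) Filter.atTop (nhds x)
  unique _ _ _ hx hy := tendsto_nhds_unique hx.2 hy.2
  surjective x := by
    have h : ∀ n : ℕ, ∃ k, dist x (α k) < (1 / 2 : ℝ) ^ n / 2 := fun n =>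
      hα.exists_dist_lt x (by positivity)
    choose p hp using h
    refine ⟨p, fun i j hij => ?_, ?_⟩
    · have h1 := hp i
      have h2 := hp j
      have h3 : (1 / 2 : ℝ) ^ j ≤ (1 / 2 : ℝ) ^ i :=
        pow_le_pow_of_le_one (by norm_num) (by norm_num) hij.le
      have h4 := dist_triangle_left (α (p i)) (α (p j)) x
      linarith
    · rw [tendsto_iff_dist_tendsto_zero]
      refine squeeze_zero (fun _ => dist_nonneg) (fun n => ?_)
        (tendsto_pow_atTop_nhds_zero_of_lt_one (r := (1 / 2 : ℝ)) (by norm_num) (by norm_num))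
      have h1 := hp n
      have h2 : (0 : ℝ) < (1 / 2 : ℝ) ^ n := by positivity
      rw [dist_comm]
      linarith

/-- The basic open ball with number `⟨n, ⟨i, k⟩⟩`: it has center `α(n)` and radius `i / (k+1)`. -/
def basicBall (α : ℕ → X) (m : ℕ) : Set X :=
  Metric.ball (α m.unpair.1) ((m.unpair.2.unpair.1 : ℝ) / ((m.unpair.2.unpair.2 : ℝ) + 1))

/-- The representation of closed sets by negative information: `p` is a name of the complement of
the union of the basic open balls with numbers `p(0), p(1), ...`. -/
def negativeRep (α : ℕ → X) (hα : DenseRange α) :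
    Representation (TopologicalSpace.Closeds X) where
  names p A := (A : Set X) = (⋃ n, basicBall α (p n))ᶜ
  unique _ _ _ hA hB := SetLike.coe_injective (hA.trans hB.symm)
  surjective A := by
    obtain ⟨p, hp⟩ := (Set.to_countable {m | basicBall α m ⊆ (A : Set X)ᶜ}).exists_eq_range
      ⟨Nat.pair 0 (Nat.pair 0 0), by simp [basicBall]⟩
    refine ⟨p, ?_⟩
    rw [eq_compl_comm]
    refine Set.Subset.antisymm (Set.iUnion_subset fun n => ?_) fun x hx => ?_
    · have : p n ∈ {m | basicBall α m ⊆ (A : Set X)ᶜ} := hp ▸ Set.mem_range_self n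
      exact this
    · obtain ⟨ε, hε, hball⟩ := Metric.isOpen_iff.1 A.isClosed.isOpen_compl x hx
      obtain ⟨k, hk⟩ := exists_nat_one_div_lt (half_pos hε)
      obtain ⟨n, hn⟩ := hα.exists_dist_lt x (Nat.one_div_pos_of_nat (α := ℝ) (n := k))
      have hm : basicBall α (Nat.pair n (Nat.pair 1 k)) =
          Metric.ball (α n) (1 / ((k : ℝ) + 1)) := by
        simp [basicBall]
      have hmem : Nat.pair n (Nat.pair 1 k) ∈ {m | basicBall α m ⊆ (A : Set X)ᶜ} := by
        change basicBall α _ ⊆ _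
        rw [hm]
        refine Set.Subset.trans (fun y hy => ?_) hball
        have h1 := Metric.mem_ball.1 hy
        have h2 := dist_triangle_right y x (α n)
        rw [Metric.mem_ball]
        linarith
      rw [hp] at hmem
      obtain ⟨j, hj⟩ := hmem
      refine Set.mem_iUnion.2 ⟨j, ?_⟩
      rw [hj, hm]
      exact hn

/-- Closed choice on `X` restricted to the closed sets in `D`: on input of a closed set `A ∈ D`
(by negative information), find a point of `A`. -/
def choiceOn (α : ℕ → X) (hα : DenseRange α) (D : Set (TopologicalSpace.Closeds X)) :
    Problem (TopologicalSpace.Closeds X) X where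
  inRep := negativeRep α hα
  outRep := cauchyRep α hα
  val A := {x | A ∈ D ∧ x ∈ A}

/-- Positive choice with respect to the measure `μ`. -/
def positiveChoice [MeasurableSpace X] (α : ℕ → X) (hα : DenseRange α)
    (μ : MeasureTheory.Measure X) : Problem (TopologicalSpace.Closeds X) X :=
  choiceOn α hα {A | 0 < μ (A : Set X)}

/-- Positive connected choice with respect to the measure `μ`. -/
def positiveConnectedChoice [MeasurableSpace X] (α : ℕ → X) (hα : DenseRange α)
    (μ : MeasureTheory.Measure X) : Problem (TopologicalSpace.Closeds X) X :=
  choiceOn α hα {A | 0 < μ (A : Set X) ∧ IsConnected (A : Set X)}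

end Metric

/-! ### The unit interval -/

/-- The dense sequence of the rational numbers in `[0,1]`: number `⟨i, k⟩` is `i / (k+1)`, cut off
at `1`. -/
noncomputable def unitRat (m : ℕ) : unitInterval :=
  Set.projIcc 0 1 zero_le_one ((m.unpair.1 : ℝ) / ((m.unpair.2 : ℝ) + 1))

theorem denseRange_unitRat : DenseRange unitRat := by
  rw [Metric.denseRange_iff]
  intro x r hr
  obtain ⟨k, hk⟩ := exists_nat_one_div_lt hr
  have hk0 : (0 : ℝ) < (k : ℝ) + 1 := by positivity
  have hx0 : 0 ≤ (x : ℝ) * ((k : ℝ) + 1) := mul_nonneg x.2.1 hk0.le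
  have h1 := Nat.floor_le hx0
  have h2 := Nat.lt_floor_add_one ((x : ℝ) * ((k : ℝ) + 1))
  set i := ⌊(x : ℝ) * ((k : ℝ) + 1)⌋₊
  have h3 : (i : ℝ) / ((k : ℝ) + 1) ≤ x := by rwa [div_le_iff₀ hk0]
  have h4 : (x : ℝ) < (i : ℝ) / ((k : ℝ) + 1) + 1 / ((k : ℝ) + 1) := by
    rwa [← add_div, lt_div_iff₀ hk0]
  have hmem : (i : ℝ) / ((k : ℝ) + 1) ∈ Set.Icc (0 : ℝ) 1 :=
    ⟨by positivity, h3.trans x.2.2⟩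
  refine ⟨Nat.pair i k, ?_⟩
  have : unitRat (Nat.pair i k) = ⟨_, hmem⟩ := by
    simp only [unitRat, Nat.unpair_pair]
    exact Set.projIcc_of_mem _ hmem
  rw [this, Subtype.dist_eq, Real.dist_eq, abs_lt]
  constructor <;> simp only <;> linarith

/-- Positive choice on `[0,1]`, with respect to Lebesgue measure. -/
noncomputable def PCI : Problem (TopologicalSpace.Closeds unitInterval) unitInterval :=
  positiveChoice unitRat denseRange_unitRat MeasureTheory.volume

/-- Positive connected choice on `[0,1]`, with respect to Lebesgue measure. -/
noncomputable def PCCI : Problem (TopologicalSpace.Closeds unitInterval) unitInterval :=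
  positiveConnectedChoice unitRat denseRange_unitRat MeasureTheory.volume

/-! ### Cantor space -/

/-- Cantor space `2^ℕ`. -/
def Cantor : Type := ℕ → Bool

/-- The metric `d(x, y) = 2^(-n)` for the first `n` with `x(n) ≠ y(n)`; its topology is the
product topology. -/
noncomputable instance : MetricSpace Cantor := PiNat.metricSpace (E := fun _ : ℕ => Bool)

/-- The product `σ`-algebra. -/
instance : MeasurableSpace Cantor := inferInstanceAs (MeasurableSpace (ℕ → Bool))

/-- The uniform measure on Cantor space, i.e. the infinite product of the uniform measures on
`{0, 1}`. -/
noncomputable def cantorMeasure : MeasureTheory.Measure Cantor :=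
  MeasureTheory.Measure.infinitePi fun _ : ℕ => (PMF.uniformOfFintype Bool).toMeasure

/-- The dense sequence of the eventually zero binary sequences: number `n` is the sequence of the
binary digits of `n`. -/
def cantorDense (n : ℕ) : Cantor := fun i => n.testBit i

theorem denseRange_cantorDense : DenseRange cantorDense := by
  rw [Metric.denseRange_iff]
  intro x r hr
  obtain ⟨n, hn⟩ := exists_pow_lt_of_lt_one hr (by norm_num : (1 / 2 : ℝ) < 1)
  refine ⟨Nat.ofBits fun i : Fin n => x i, lt_of_le_of_lt ?_ hn⟩
  refine (PiNat.mem_cylinder_iff_dist_le (E := fun _ : ℕ => Bool) (y := x)).1 fun i hi => ?_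
  simp [cantorDense, Nat.testBit_ofBits_lt _ _ hi]

/-- Positive choice on Cantor space, with respect to the uniform measure. -/
noncomputable def PCCantor : Problem (TopologicalSpace.Closeds Cantor) Cantor :=
  positiveChoice cantorDense denseRange_cantorDense cantorMeasure

end WeihrauchChoice

/-!
Every problem is reducible to its completion: increase all entries of the input by one, and delete the
zeros of the output again.  The three negative statements follow from one theorem,
`not_completion_choiceOn_le_positiveChoice`, about the completion of a closed choice problem whose
domain contains a family of "good" closed sets, each of which has two disjoint good subsets that arise
by removing one basic ball.  On `[0,1]` the good sets are the nondegenerate closed intervals, on Cantor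
space they are the cylinders.

Suppose that computable `H` and `K` reduce such a completion to positive choice.  As every sequence is
a name in the completion, `K` maps *every* sequence to a name of a closed set of positive measure.
That measure is upper semicontinuous, so a Baire category argument (`exists_uniform_lower_bound`) yields
a good finite stage `l` and an `ε > 0` such that all names of good sets that extend `l` are mapped to
sets of measure at least `ε`.  Consider the name `p` which removes nothing after `l`, and the closed
set `A` named by `K p`.  Every `x` in `A` is turned by `H` into some solution.  Halving repeatedly,
one finds a good `T` that is reachable after `l` such that less than `ε` of the points `x` are turned
into points of `T` (`exists_small_measure_of_split`).  That a point of `A` is turned into a point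
outside `T` is visible at a finite stage (`exists_mem_avoiding`), and also the measure of `A` is
approximated from above at finite stages.  If the name `p` is switched to a name of `T` late enough, then
the set of answers still has measure at least `ε`, and hence contains a point whose solution is already
committed to lie outside `T`, which is a contradiction.

Measurability of the sets of answers is guaranteed by selecting the names of the answers measurably
(`exists_measurable_cauchyName`).
-/

namespace WeihrauchChoice

open MeasureTheory Filter
open scoped ENNReal

/-! ### Continuity and realizers -/

/-- `p` and `q` agree on their first `n` entries. -/
def AgreeBelow (n : ℕ) (p q : Baire) : Prop := ∀ i < n, p i = q i

theorem AgreeBelow.mono {m n : ℕ} {p q : Baire} (h : AgreeBelow n p q) (hmn : m ≤ n) :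
    AgreeBelow m p q := fun i hi => h i (hi.trans_le hmn)

theorem prefixWord_eq_iff {p q : Baire} {n : ℕ} :
    prefixWord p n = prefixWord q n ↔ AgreeBelow n p q := by
  simp [prefixWord, AgreeBelow]

theorem AgreeBelow.pairing {n : ℕ} {p p' q q' : Baire} (hp : AgreeBelow n p p')
    (hq : AgreeBelow n q q') : AgreeBelow n (pairing p q) (pairing p' q') := by
  intro i hi
  have hi' : i / 2 < n := by omega
  simp [WeihrauchChoice.pairing, hp _ hi', hq _ hi']

/-- Computable functions on Baire space are continuous: finitely many entries of the input determine
any given number of entries of the output. -/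
theorem IsComputable.exists_modulus {F : Baire →. Baire} (hF : IsComputable F) {p q : Baire}
    (hq : q ∈ F p) (n : ℕ) :
    ∃ m, ∀ p', AgreeBelow m p p' → ∀ q' ∈ F p', AgreeBelow n q q' := by
  obtain ⟨φ, -, -, h⟩ := hF
  obtain ⟨m, hm⟩ := (h p q hq).2 n
  refine ⟨m, fun p' hp' q' hq' => ?_⟩
  have h1 := (h p q hq).1 m
  have h2 := (h p' q' hq').1 m
  rw [← prefixWord_eq_iff.2 hp'] at h2
  exact (prefixWord_eq_iff.1 (h1.symm.trans h2)).mono hm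

/-- There is a realizer that is undefined off the names of points of the domain.  It forces every
reduction to `g` to ask only questions in the domain of `g`. -/
theorem exists_realizer_dom_subset {X Y : Type*} (g : Problem X Y) :
    ∃ G, Realizes G g ∧ ∀ k, ∀ q ∈ G k, ∃ u, g.inRep.names k u ∧ u ∈ g.dom := by
  have key : ∀ k, (∃ u, g.inRep.names k u ∧ u ∈ g.dom) →
      ∃ q, ∃ u v, g.inRep.names k u ∧ v ∈ g.val u ∧ g.outRep.names q v := by
    rintro k ⟨u, hu, v, hv⟩
    obtain ⟨q, hq⟩ := g.outRep.surjective v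
    exact ⟨q, u, v, hu, hv, hq⟩
  choose s hs using key
  refine ⟨fun k => ⟨_, s k⟩, fun k' x hx hd => ?_, fun k q hq => hq.1⟩
  obtain ⟨u', v', hu', hv', hq'⟩ := hs k' ⟨x, hx, hd⟩
  obtain rfl := g.inRep.unique _ _ _ hx hu'
  exact ⟨_, ⟨⟨x, hx, hd⟩, rfl⟩, v', hv', hq'⟩

/-- Any admissible answer to a single question is the answer of some realizer. -/
theorem exists_realizer_apply_eq {X Y : Type*} (g : Problem X Y) {k q : Baire} {u : X} {v : Y}
    (hk : g.inRep.names k u) (hv : v ∈ g.val u) (hq : g.outRep.names q v) :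
    ∃ G, Realizes G g ∧ G k = Part.some q := by
  classical
  obtain ⟨G, hG, -⟩ := exists_realizer_dom_subset g
  refine ⟨fun k' => if k' = k then Part.some q else G k', fun k' x hx hd => ?_, by simp⟩
  by_cases hkk : k' = k
  · subst hkk
    obtain rfl := g.inRep.unique _ _ _ hx hk
    exact ⟨q, by simp, v, hv, hq⟩
  · simp only [if_neg hkk]
    exact hG k' x hx hd

/-- What a reduction says about one input: it asks one question `k`, naming a point of the domain of
`g`, and turns every name of every admissible answer into a solution. -/
theorem exists_query {X Y U V : Type*} {f : Problem X Y} {g : Problem U V} {H K : Baire →. Baire}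
    (h : ∀ G, Realizes G g → Realizes (sandwich H G K) f) {p : Baire} {x : X}
    (hp : f.inRep.names p x) (hx : x ∈ f.dom) :
    ∃ k ∈ K p, ∃ u, g.inRep.names k u ∧ u ∈ g.dom ∧ ∀ v ∈ g.val u, ∀ q, g.outRep.names q v →
      ∃ r ∈ H (pairing p q), ∃ y ∈ f.val x, f.outRep.names r y := by
  obtain ⟨G, hG, hGdom⟩ := exists_realizer_dom_subset g
  obtain ⟨r, hr, -⟩ := h G hG p x hp hx
  simp only [sandwich, Part.mem_bind_iff] at hr
  obtain ⟨k, hk, q, hq, -⟩ := hr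
  obtain ⟨u, hu, hud⟩ := hGdom k q hq
  refine ⟨k, hk, u, hu, hud, fun v hv q hq => ?_⟩
  obtain ⟨G', hG', hG'k⟩ := exists_realizer_apply_eq g hu hv hq
  obtain ⟨r, hr, hy⟩ := h G' hG' p x hp hx
  simp only [sandwich, Part.mem_bind_iff] at hr
  obtain ⟨k', hk', q', hq', hr⟩ := hr
  obtain rfl := Part.mem_unique hk hk'
  rw [hG'k, Part.mem_some_iff] at hq'
  subst hq'
  exact ⟨r, hr, hy⟩

theorem Problem.mem_dom_completion {X Y : Type*} (f : Problem X Y) (x : Option X) :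
    x ∈ f.completion.dom := by
  by_cases h : ∃ x', x = some x' ∧ x' ∈ f.dom
  · obtain ⟨x', rfl, y, hy⟩ := h
    exact ⟨some y, fun z hz _ => ⟨y, Option.some.inj hz ▸ hy, rfl⟩⟩
  · exact ⟨none, fun x' h1 h2 => (h ⟨x', h1, h2⟩).elim⟩

theorem Representation.exists_completion_names {X : Type*} (δ : Representation X) (p : Baire) :
    ∃ x, δ.completion.names p x := by
  by_cases h : ∃ x, δ.precompletionNames p x
  · obtain ⟨x, hx⟩ := h
    exact ⟨some x, hx⟩
  · exact ⟨none, h⟩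

/-! ### Names of finite stages and Baire category -/

/-- The completion name which lists the ball numbers in `l` and then the number `0` of an empty ball
forever; every entry is increased by one, so that `decrement` deletes nothing. -/
def listName (l : List ℕ) : Baire := fun i => l.getD i 0 + 1

theorem agreeBelow_listName_of_prefix {l l' : List ℕ} (h : l <+: l') :
    AgreeBelow l.length (listName l) (listName l') := by
  obtain ⟨t, rfl⟩ := h
  intro i hi
  simp [listName, List.getElem?_append_left hi]

theorem listName_append_replicate (l : List ℕ) (n : ℕ) :
    listName (l ++ List.replicate n 0) = listName l := by
  funext i
  simp only [listName, List.getD_eq_getElem?_getD, List.getElem?_append, List.getElem?_replicate]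
  split_ifs with h1 h2
  · rfl
  · simp [List.getElem?_eq_none (not_lt.1 h1)]
  · simp [List.getElem?_eq_none (not_lt.1 h1)]

/-- A Baire category argument on the names `listName l` with `l` good.  If no uniform lower bound
held below any good list, then upper semicontinuity of `m` would allow to extend good lists step by
step, forcing `m` below `1 / n` in step `n`, and `m` would vanish at the limit.  That limit is an
arbitrary point of Baire space, and so `m` has to be positive everywhere. -/
theorem exists_uniform_lower_bound {m : Baire → ℝ≥0∞} (hpos : ∀ p, m p ≠ 0)
    (husc : ∀ p c, m p < c → ∃ n, ∀ p', AgreeBelow n p p' → m p' < c)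
    {good : Set (List ℕ)} (hnil : [] ∈ good)
    (hpad : ∀ l ∈ good, ∀ n, l ++ List.replicate n 0 ∈ good) :
    ∃ l ∈ good, ∃ ε ≠ 0, ∀ e, l ++ e ∈ good → ε ≤ m (listName (l ++ e)) := by
  by_contra! hcon
  -- The padding by `k + 1` zeros makes the list long enough to fix `m < 1 / n`, and strictly longer.
  have step : ∀ (l : good) (n : ℕ), ∃ l' : good, l.1 <+: l'.1 ∧ l.1.length < l'.1.length ∧
      ∀ p', AgreeBelow l'.1.length (listName l'.1) p' → m p' < (n : ℝ≥0∞)⁻¹ := by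
    rintro ⟨l, hl⟩ n
    obtain ⟨e, he, hlt⟩ := hcon l hl (n : ℝ≥0∞)⁻¹ (by simp)
    obtain ⟨k, hk⟩ := husc _ _ hlt
    refine ⟨⟨_, hpad _ he (k + 1)⟩, ?_, by simp, fun p' hp' => hk p' ?_⟩
    · exact (List.prefix_append l e).trans (List.prefix_append _ _)
    · rw [listName_append_replicate] at hp'
      exact hp'.mono (by simp; omega)
  choose S hS1 hS2 hS3 using step
  let L : ℕ → good := fun n => Nat.rec ⟨[], hnil⟩ (fun i l => S l i) n
  have hL : ∀ n, L (n + 1) = S (L n) n := fun _ => rfl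
  have hmono : ∀ i j, i ≤ j → (L i).1 <+: (L j).1 := by
    intro i j hij
    induction j, hij using Nat.le_induction with
    | base => exact List.prefix_rfl
    | succ j _ ih => exact ih.trans (hL j ▸ hS1 _ _)
  have hlen : ∀ n, n ≤ (L n).1.length := by
    intro n
    induction n with
    | zero => exact Nat.zero_le _
    | succ n ih => rw [hL]; exact Nat.succ_le_of_lt (ih.trans_lt (hS2 _ _))
  let p : Baire := fun i => listName (L (i + 1)).1 i
  have hp : ∀ n, AgreeBelow (L n).1.length (listName (L n).1) p := by
    intro n i hi
    rcases le_total n (i + 1) with h | h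
    · exact agreeBelow_listName_of_prefix (hmono _ _ h) i hi
    · exact (agreeBelow_listName_of_prefix (hmono _ _ h) i (hlen (i + 1))).symm
  obtain ⟨n, hn⟩ := ENNReal.exists_inv_nat_lt (hpos p)
  exact (hS3 (L n) n p (hL n ▸ hp (n + 1))).not_gt hn

/-! ### Closed sets and points in a metric space -/

section Metric
variable {X : Type*} [MetricSpace X]

/-- The closed set that is left after removing the basic balls with numbers in `l`. -/
def remaining (α : ℕ → X) (l : List ℕ) : Set X := {x | ∀ b ∈ l, x ∉ basicBall α b}

/-- The closed set named by `k` in the negative representation. -/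
def complementOf (α : ℕ → X) (k : Baire) : Set X := (⋃ n, basicBall α (k n))ᶜ

theorem remaining_append (α : ℕ → X) (l e : List ℕ) :
    remaining α (l ++ e) = remaining α l ∩ remaining α e := by
  ext x
  simp [remaining, or_imp, forall_and]

theorem remaining_nil (α : ℕ → X) : remaining α [] = Set.univ := by
  simp [remaining]

theorem basicBall_zero (α : ℕ → X) : basicBall α 0 = ∅ := by
  simp [basicBall]

theorem isOpen_basicBall (α : ℕ → X) (b : ℕ) : IsOpen (basicBall α b) := Metric.isOpen_ball

theorem remaining_append_replicate (α : ℕ → X) (l : List ℕ) (n : ℕ) :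
    remaining α (l ++ List.replicate n 0) = remaining α l := by
  rw [remaining_append, Set.inter_eq_left]
  intro x _ b hb
  simp [List.eq_of_mem_replicate hb, basicBall_zero]

theorem isClosed_remaining (α : ℕ → X) (l : List ℕ) : IsClosed (remaining α l) := by
  have : remaining α l = ⋂ b ∈ l, (basicBall α b)ᶜ := by ext; simp [remaining]
  rw [this]
  exact isClosed_biInter fun b _ => (isOpen_basicBall α b).isClosed_compl

theorem complementOf_eq_iInter (α : ℕ → X) (k : Baire) :
    complementOf α k = ⋂ n, remaining α (prefixWord k n) := by
  ext x
  simp only [complementOf, remaining, prefixWord, Set.mem_compl_iff, Set.mem_iUnion, not_exists,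
    Set.mem_iInter, Set.mem_ofPred_eq, List.mem_map, List.mem_range]
  constructor
  · rintro h n _ ⟨i, -, rfl⟩
    exact h i
  · exact fun h n => h (n + 1) _ ⟨n, n.lt_succ_self, rfl⟩

theorem antitone_remaining_prefixWord (α : ℕ → X) (k : Baire) :
    Antitone fun n => remaining α (prefixWord k n) := by
  intro m n hmn x hx b hb
  simp only [prefixWord, List.mem_map, List.mem_range] at hb
  obtain ⟨i, hi, rfl⟩ := hb
  exact hx _ (by simpa [prefixWord] using ⟨i, hi.trans_le hmn, rfl⟩)

theorem complementOf_getD (α : ℕ → X) (l : List ℕ) :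
    complementOf α (fun i => l.getD i 0) = remaining α l := by
  ext x
  simp only [complementOf, remaining, Set.mem_compl_iff, Set.mem_iUnion, not_exists,
    Set.mem_ofPred_eq]
  constructor
  · intro h b hb
    obtain ⟨i, hi, rfl⟩ := List.mem_iff_getElem.1 hb
    simpa [hi] using h i
  · intro h i
    by_cases hi : i < l.length
    · simpa [hi] using h _ (List.getElem_mem hi)
    · simp [List.getElem?_eq_none (not_lt.1 hi), basicBall_zero]

theorem precompletionNames_listName (α : ℕ → X) (hα : DenseRange α) (l : List ℕ) :
    (negativeRep α hα).precompletionNames (listName l) ⟨remaining α l, isClosed_remaining α l⟩ := by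
  refine ⟨by simpa [listName] using Set.infinite_univ (α := ℕ), ?_⟩
  unfold listName
  rw [decrement_succ]
  exact (complementOf_getD α l).symm

theorem nth_congr_of_agreeBelow {r r' : Baire} {n i : ℕ} (h : AgreeBelow n r r')
    (hr : {j | r j ≠ 0}.Infinite) (hi : Nat.nth (fun j => r j ≠ 0) i < n) :
    Nat.nth (fun j => r' j ≠ 0) i = Nat.nth (fun j => r j ≠ 0) i := by
  set k := Nat.nth (fun j => r j ≠ 0) i with hk
  have hc : Nat.count (fun j => r' j ≠ 0) k = i := by
    rw [← Nat.count_nth_of_infinite (p := fun j => r j ≠ 0) hr i, ← hk]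
    simp only [Nat.count_eq_card_filter_range]
    congr 1
    refine Finset.filter_congr fun j hj => ?_
    rw [h j ((Finset.mem_range.1 hj).trans hi)]
  have hk0 : r' k ≠ 0 := by
    rw [← h k hi]
    exact Nat.nth_mem_of_infinite (p := fun j => r j ≠ 0) hr i
  rw [← hc]
  exact Nat.nth_count (p := fun j => r' j ≠ 0) hk0

/-- The entries of a Cauchy name approximate the named point at the rate `2 ^ (-i)`. -/
theorem cauchyRep_dist_le {α : ℕ → X} {hα : DenseRange α} {p : Baire} {x : X}
    (h : (cauchyRep α hα).names p x) (i : ℕ) : dist (α (p i)) x ≤ (1 / 2 : ℝ) ^ i := by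
  refine le_of_tendsto (tendsto_const_nhds.dist h.2) ?_
  filter_upwards [eventually_gt_atTop i] with j hj using h.1 i j hj

/-- A precompletion name of a point outside the closed set `T` reveals this after finitely many
entries. -/
theorem exists_agreeBelow_notMem {α : ℕ → X} {hα : DenseRange α} {r : Baire} {y : X} {T : Set X}
    (hr : (cauchyRep α hα).precompletionNames r y) (hT : IsClosed T) (hy : y ∉ T) :
    ∃ n, ∀ r', AgreeBelow n r r' → ∀ y', (cauchyRep α hα).precompletionNames r' y' → y' ∉ T := by
  obtain ⟨ε, hε, hball⟩ := Metric.isOpen_iff.1 hT.isOpen_compl y hy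
  obtain ⟨i, hi⟩ := exists_pow_lt_of_lt_one (half_pos hε) (by norm_num : (1 / 2 : ℝ) < 1)
  refine ⟨Nat.nth (fun j => r j ≠ 0) i + 1, fun r' h y' hy' => hball ?_⟩
  have h1 := cauchyRep_dist_le hr.2 i
  have h2 := cauchyRep_dist_le hy'.2 i
  have h3 : decrement r' i = decrement r i := by
    simp only [decrement]
    rw [nth_congr_of_agreeBelow h hr.1 (Nat.lt_succ_self _), h _ (Nat.lt_succ_self _)]
  rw [h3] at h2
  rw [Metric.mem_ball]
  linarith [dist_triangle_left y' y (α (decrement r i))]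

/-- Cauchy names can be selected measurably: take the first sufficiently good approximation at each
precision. -/
theorem exists_measurable_cauchyName [MeasurableSpace X] [OpensMeasurableSpace X] (α : ℕ → X)
    (hα : DenseRange α) :
    ∃ q : X → Baire, (∀ x, (cauchyRep α hα).names (q x) x) ∧ Measurable q := by
  classical
  have h : ∀ (n : ℕ) (x : X), ∃ k, dist x (α k) < (1 / 2 : ℝ) ^ n / 2 := fun n x =>
    hα.exists_dist_lt x (by positivity)
  refine ⟨fun x n => Nat.find (h n x), fun x => ?_, measurable_pi_iff.2 fun n =>
    measurable_find (h n) fun k => ?_⟩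
  · have hp : ∀ n, dist x (α (Nat.find (h n x))) < (1 / 2 : ℝ) ^ n / 2 := fun n =>
      Nat.find_spec (h n x)
    refine ⟨fun i j hij => ?_, ?_⟩
    · have h3 : (1 / 2 : ℝ) ^ j ≤ (1 / 2 : ℝ) ^ i :=
        pow_le_pow_of_le_one (by norm_num) (by norm_num) hij.le
      linarith [hp i, hp j, dist_triangle_left (α (Nat.find (h i x))) (α (Nat.find (h j x))) x]
    · rw [tendsto_iff_dist_tendsto_zero]
      refine squeeze_zero (fun _ => dist_nonneg) (fun n => ?_)
        (tendsto_pow_atTop_nhds_zero_of_lt_one (r := (1 / 2 : ℝ)) (by norm_num) (by norm_num))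
      have h2 : (0 : ℝ) < (1 / 2 : ℝ) ^ n := by positivity
      rw [dist_comm]
      linarith [hp n]
  · exact (isOpen_lt (continuous_id.dist continuous_const) continuous_const).measurableSet

/-- The measure of a closed set is upper semicontinuous in its negative names. -/
theorem exists_agreeBelow_measure_lt [MeasurableSpace X] [OpensMeasurableSpace X] (α : ℕ → X)
    (μ : Measure X) [IsFiniteMeasure μ] {k : Baire} {c : ℝ≥0∞} (h : μ (complementOf α k) < c) :
    ∃ n, ∀ k', AgreeBelow n k k' → μ (complementOf α k') < c := by
  have ht := tendsto_measure_iInter_atTop (μ := μ)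
    (fun n => (isClosed_remaining α (prefixWord k n)).nullMeasurableSet)
    (antitone_remaining_prefixWord α k) ⟨0, measure_ne_top _ _⟩
  rw [← complementOf_eq_iInter] at ht
  obtain ⟨n, hn⟩ := (ht.eventually_lt_const h).exists
  refine ⟨n, fun k' hk' => lt_of_le_of_lt (measure_mono ?_) hn⟩
  simp only [prefixWord_eq_iff.2 hk', complementOf_eq_iInter α k']
  exact Set.iInter_subset _ n

end Metric

/-- A property of `q x` that depends only on its first `n` entries defines a measurable set. -/
theorem measurableSet_of_agreeBelow {X : Type*} [MeasurableSpace X] {q : X → Baire}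
    (hq : Measurable q) (n : ℕ) {s : Set Baire} (hs : ∀ a b, AgreeBelow n a b → a ∈ s → b ∈ s) :
    MeasurableSet (q ⁻¹' s) := by
  have hm : Measurable fun x (i : Fin n) => q x i :=
    measurable_pi_iff.2 fun i => (measurable_pi_apply (i : ℕ)).comp hq
  have : q ⁻¹' s = (fun x (i : Fin n) => q x i) ⁻¹' ((fun (a : Baire) (i : Fin n) => a i) '' s) := by
    ext x
    constructor
    · exact fun hx => ⟨q x, hx, rfl⟩
    · rintro ⟨a, ha, hax⟩
      exact hs a (q x) (fun i hi => congrFun hax ⟨i, hi⟩) ha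
  rw [this]
  exact hm (Set.to_countable _).measurableSet

/-! ### The completion of a choice problem is not reducible to positive choice -/

section NotReducible

variable {X Y : Type*} [MetricSpace X] [MetricSpace Y]

/-- A reduction of the completion of a choice problem to positive choice asks for a point of a closed
set of positive measure on *every* input `p`, since every sequence is a name in the completion. -/
theorem exists_query_positiveChoice [MeasurableSpace X] {α : ℕ → X} {hα : DenseRange α}
    {μ : Measure X} {β : ℕ → Y} {hβ : DenseRange β} {D : Set (TopologicalSpace.Closeds Y)}
    {H K : Baire →. Baire}
    (h : ∀ G, Realizes G (positiveChoice α hα μ) →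
      Realizes (sandwich H G K) (choiceOn β hβ D).completion) (p : Baire) :
    ∃ k ∈ K p, μ (complementOf α k) ≠ 0 ∧
      ∀ C ∈ D, (C : Set Y).Nonempty → (negativeRep β hβ).precompletionNames p C →
        ∀ x ∈ complementOf α k, ∀ q, (cauchyRep α hα).names q x →
          ∃ r ∈ H (pairing p q), ∃ y ∈ C, (cauchyRep β hβ).precompletionNames r y := by
  obtain ⟨c, hc⟩ := (negativeRep β hβ).exists_completion_names p
  obtain ⟨k, hk, A, hA, ⟨-, hpos, -⟩, hout⟩ :=
    exists_query h hc ((choiceOn β hβ D).mem_dom_completion c)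
  have hA' : (A : Set X) = complementOf α k := hA
  refine ⟨k, hk, hA' ▸ hpos.ne', fun C hCD hCne hpC x hx q hq => ?_⟩
  obtain ⟨r, hr, y, hy, hry⟩ := hout x ⟨hpos, hA'.ge hx⟩ q hq
  obtain rfl : c = some C := (negativeRep β hβ).completion.unique p _ _ hc hpC
  obtain ⟨z, hz⟩ := hCne
  obtain ⟨y', ⟨-, hy'⟩, rfl⟩ := hy C rfl ⟨z, hCD, hz⟩
  exact ⟨r, hr, y', hy', hry⟩

/-- The sequences `q` whose first `m` entries, together with those of `p`, already guarantee that the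
output of `H` does not name a point of `T`. -/
def avoiding (β : ℕ → Y) (hβ : DenseRange β) (H : Baire →. Baire) (p : Baire) (T : Set Y) (m : ℕ) :
    Set Baire :=
  {q | ∀ p', AgreeBelow m p p' → ∀ q', AgreeBelow m q q' → ∀ r ∈ H (pairing p' q'),
    ∀ y, (cauchyRep β hβ).precompletionNames r y → y ∉ T}

theorem avoiding_mono (β : ℕ → Y) (hβ : DenseRange β) (H : Baire →. Baire) (p : Baire) (T : Set Y) :
    Monotone (avoiding β hβ H p T) :=
  fun _ _ hmn _ hq p' hp' q' hq' => hq p' (hp'.mono hmn) q' (hq'.mono hmn)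

theorem avoiding_anti (β : ℕ → Y) (hβ : DenseRange β) (H : Baire →. Baire) (p : Baire)
    {T T' : Set Y} (h : T' ⊆ T) (m : ℕ) : avoiding β hβ H p T m ⊆ avoiding β hβ H p T' m :=
  fun _ hq p' hp' q' hq' r hr y hy hyT => hq p' hp' q' hq' r hr y hy (h hyT)

theorem measurableSet_preimage_avoiding {X : Type*} [MeasurableSpace X] {q : X → Baire}
    (hq : Measurable q) (β : ℕ → Y) (hβ : DenseRange β) (H : Baire →. Baire) (p : Baire)
    (T : Set Y) (m : ℕ) :
    MeasurableSet (q ⁻¹' avoiding β hβ H p T m) :=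
  measurableSet_of_agreeBelow hq m fun _ _ hab ha p' hp' q' hq' =>
    ha p' hp' q' fun i hi => (hab i hi).trans (hq' i hi)

theorem exists_mem_avoiding {β : ℕ → Y} {hβ : DenseRange β} {H : Baire →. Baire}
    (hH : IsComputable H) {p q r : Baire} {y : Y} {T : Set Y} (hr : r ∈ H (pairing p q))
    (hy : (cauchyRep β hβ).precompletionNames r y) (hT : IsClosed T) (hyT : y ∉ T) :
    ∃ m, q ∈ avoiding β hβ H p T m := by
  obtain ⟨n, hn⟩ := exists_agreeBelow_notMem hy hT hyT
  obtain ⟨m, hm⟩ := hH.exists_modulus hr n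
  exact ⟨m, fun p' hp' q' hq' r' hr' y' hy' => hn r' (hm _ (hp'.pairing hq') r' hr') y' hy'⟩

/-- If every good set splits into two disjoint good ones, then a disjointness preserving `S` gets
arbitrarily small along them: of two disjoint halves one has at most half the measure. -/
theorem exists_small_measure_of_split {X : Type*} [MeasurableSpace X] {μ : Measure X}
    [IsFiniteMeasure μ] {β : ℕ → Y} {good : Set (Set Y)}
    (hsplit : ∀ C ∈ good, ∃ a b, C \ basicBall β a ∈ good ∧ C \ basicBall β b ∈ good ∧
      Disjoint (C \ basicBall β a) (C \ basicBall β b))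
    {S : Set Y → Set X} (hSmeas : ∀ T, MeasurableSet (S T)) (hSmono : Monotone S)
    (hSdisj : ∀ T T', IsClosed T → IsClosed T' → Disjoint T T' → Disjoint (S T) (S T'))
    {l : List ℕ} (hl : remaining β l ∈ good) {ε : ℝ≥0∞} (hε : ε ≠ 0) :
    ∃ e, remaining β (l ++ e) ∈ good ∧ μ (S (remaining β (l ++ e))) < ε := by
  have hrem : ∀ e a, remaining β (l ++ (e ++ [a])) = remaining β (l ++ e) \ basicBall β a := by
    intro e a
    rw [← List.append_assoc, remaining_append]
    ext y
    simp [remaining]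
  have key : ∀ n : ℕ, ∃ e, remaining β (l ++ e) ∈ good ∧
      2 ^ n * μ (S (remaining β (l ++ e))) ≤ μ Set.univ := by
    intro n
    induction n with
    | zero => exact ⟨[], by simpa using hl, by simpa using measure_mono (Set.subset_univ _)⟩
    | succ n ih =>
      obtain ⟨e, he, hle⟩ := ih
      obtain ⟨a, b, ha, hb, hab⟩ := hsplit _ he
      rw [← hrem] at ha hb
      rw [← hrem, ← hrem] at hab
      have hsum : μ (S (remaining β (l ++ (e ++ [a])))) + μ (S (remaining β (l ++ (e ++ [b])))) ≤
          μ (S (remaining β (l ++ e))) := by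
        rw [← measure_union (hSdisj _ _ (isClosed_remaining _ _) (isClosed_remaining _ _) hab)
          (hSmeas _)]
        refine measure_mono (Set.union_subset (hSmono ?_) (hSmono ?_)) <;>
        · rw [hrem]; exact Set.sdiff_subset
      rcases le_total (μ (S (remaining β (l ++ (e ++ [a])))))
        (μ (S (remaining β (l ++ (e ++ [b]))))) with hc | hc
      · refine ⟨_, ha, le_trans ?_ hle⟩
        rw [pow_succ, mul_assoc, two_mul]
        gcongr
        exact le_trans (by gcongr) hsum
      · refine ⟨_, hb, le_trans ?_ hle⟩
        rw [pow_succ, mul_assoc, two_mul]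
        gcongr
        exact le_trans (by gcongr) hsum
  obtain ⟨n, hn⟩ := ENNReal.exists_nat_mul_gt hε (measure_ne_top μ Set.univ)
  obtain ⟨e, he, hle⟩ := key n
  refine ⟨e, he, lt_of_not_ge fun hge => hn.not_ge (le_trans ?_ hle)⟩
  gcongr
  exact_mod_cast Nat.lt_two_pow_self.le

/-- The completion of closed choice is not reducible to positive choice if the domain contains a
family of closed sets, starting with the whole space, in which every member has two disjoint members
that each arise from it by removing one basic ball. -/
theorem not_completion_choiceOn_le_positiveChoice [MeasurableSpace X]
    [OpensMeasurableSpace X] (α : ℕ → X) (hα : DenseRange α) (μ : Measure X)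
    [IsFiniteMeasure μ] (β : ℕ → Y) (hβ : DenseRange β) (D : Set (TopologicalSpace.Closeds Y))
    (good : Set (Set Y)) (huniv : Set.univ ∈ good)
    (hgood : ∀ C : TopologicalSpace.Closeds Y, (C : Set Y) ∈ good → C ∈ D ∧ (C : Set Y).Nonempty)
    (hsplit : ∀ C ∈ good, ∃ a b, C \ basicBall β a ∈ good ∧ C \ basicBall β b ∈ good ∧
      Disjoint (C \ basicBall β a) (C \ basicBall β b)) :
    ¬ WeihrauchLE (choiceOn β hβ D).completion (positiveChoice α hα μ) := by
  rintro ⟨H, K, hH, hK, h⟩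
  choose k hk hpos hout using exists_query_positiveChoice h
  have hmod : ∀ p n, ∃ m, ∀ p', AgreeBelow m p p' → AgreeBelow n (k p) (k p') := fun p n =>
    (hK.exists_modulus (hk p) n).imp fun m hm p' hp' => hm p' hp' _ (hk p')
  obtain ⟨q, hq, hqm⟩ := exists_measurable_cauchyName α hα
  obtain ⟨l, hl, ε, hε, hlow⟩ := exists_uniform_lower_bound
    (m := fun p => μ (complementOf α (k p))) hpos
    (fun p c hc => by
      obtain ⟨n, hn⟩ := exists_agreeBelow_measure_lt α μ hc
      obtain ⟨m, hm⟩ := hmod p n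
      exact ⟨m, fun p' hp' => hn _ (hm p' hp')⟩)
    (good := {l | remaining β l ∈ good}) (by simpa [remaining_nil] using huniv)
    (fun l hl n => by simpa [remaining_append_replicate] using hl)
  have hout' : ∀ l, remaining β l ∈ good → ∀ x ∈ complementOf α (k (listName l)),
      ∃ r ∈ H (pairing (listName l) (q x)), ∃ y ∈ remaining β l,
        (cauchyRep β hβ).precompletionNames r y := fun l hl x hx =>
    hout _ ⟨remaining β l, isClosed_remaining β l⟩ (hgood _ hl).1 (hgood _ hl).2
      (precompletionNames_listName β hβ l) x hx _ (hq x)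
  -- Below `l` all questions have measure at least `ε`.  Fix the question asked on `p`; for a closed
  -- set `T` of solutions, `S T` is the set of the answers `x` that `H` turns into points of `T`.
  set p := listName l with hp
  have hAmeas : MeasurableSet (complementOf α (k p)) := by
    rw [complementOf_eq_iInter]
    exact MeasurableSet.iInter fun n => (isClosed_remaining _ _).measurableSet
  let S : Set Y → Set X := fun T => complementOf α (k p) \ ⋃ m, q ⁻¹' avoiding β hβ H p T m
  obtain ⟨e, he, hlt⟩ := exists_small_measure_of_split (μ := μ) hsplit (S := S)
    (fun T => hAmeas.diff (MeasurableSet.iUnion fun m =>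
      measurableSet_preimage_avoiding hqm β hβ H p T m))
    (fun T T' hTT => Set.sdiff_subset_sdiff_right (Set.iUnion_mono fun m =>
      Set.preimage_mono (avoiding_anti β hβ H p hTT m)))
    (fun T T' hT hT' hdisj => by
      rw [Set.disjoint_left]
      rintro x ⟨hx, hxT⟩ ⟨-, hxT'⟩
      obtain ⟨r, hr, y, -, hy⟩ := hout' l hl x hx
      rw [Set.mem_iUnion] at hxT hxT'
      have hyT : y ∈ T := by_contra fun hyT => hxT (exists_mem_avoiding hH hr hy hT hyT)
      have hyT' : y ∈ T' := by_contra fun hyT => hxT' (exists_mem_avoiding hH hr hy hT' hyT)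
      exact Set.disjoint_left.1 hdisj hyT hyT') hl hε
  -- All answers outside `S T` are seen to miss `T` after finitely many steps.  So at some stage `n`
  -- all but measure `ε` of the points not yet removed from the question are seen to miss `T`.
  set T := remaining β (l ++ e) with hT
  have ht := tendsto_measure_iInter_atTop (μ := μ)
    (s := fun n => remaining α (prefixWord (k p) n) \ q ⁻¹' avoiding β hβ H p T n)
    (fun n => ((isClosed_remaining α _).measurableSet.diff
      (measurableSet_preimage_avoiding hqm β hβ H p T n)).nullMeasurableSet)
    (fun m n hmn => Set.sdiff_subset_sdiff (antitone_remaining_prefixWord α (k p) hmn)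
      (Set.preimage_mono (avoiding_mono β hβ H p T hmn))) ⟨0, measure_ne_top _ _⟩
  have hST : ⋂ n, remaining α (prefixWord (k p) n) \ q ⁻¹' avoiding β hβ H p T n = S T := by
    simp only [S, complementOf_eq_iInter, Set.sdiff_eq, Set.compl_iUnion, Set.iInter_inter_distrib]
  rw [hST] at ht
  obtain ⟨n, hn⟩ := (ht.eventually_lt_const hlt).exists
  obtain ⟨m, hm⟩ := hmod p n
  -- Switch to a name of `T` that agrees with `p` up to that stage.
  set l' := l ++ (List.replicate (max m n) 0 ++ e) with hl'
  have hl'T : remaining β l' = T := by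
    rw [hl', ← List.append_assoc, remaining_append, remaining_append_replicate, ← remaining_append]
  have hagree : AgreeBelow (max m n) p (listName l') := by
    rw [hp, ← listName_append_replicate l (max m n)]
    refine (agreeBelow_listName_of_prefix ?_).mono (n := (l ++ List.replicate (max m n) 0).length)
      (by simp)
    rw [hl', ← List.append_assoc]
    exact List.prefix_append _ _
  have hl'good : remaining β l' ∈ good := hl'T ▸ he
  have hge : ε ≤ μ (complementOf α (k (listName l'))) := hlow _ hl'good
  obtain ⟨x, hx, hxn⟩ : ∃ x ∈ complementOf α (k (listName l')),
      x ∉ remaining α (prefixWord (k p) n) \ q ⁻¹' avoiding β hβ H p T n := by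
    by_contra! hcon
    exact (hge.trans (measure_mono hcon)).not_gt hn
  have hxrem : x ∈ remaining α (prefixWord (k p) n) := by
    rw [prefixWord_eq_iff.2 (hm _ (hagree.mono (le_max_left _ _)))]
    rw [complementOf_eq_iInter] at hx
    exact Set.mem_iInter.1 hx n
  have hav : q x ∈ avoiding β hβ H p T n := not_not.1 fun hna => hxn ⟨hxrem, hna⟩
  obtain ⟨r, hr, y, hy, hry⟩ := hout' l' hl'good x hx
  exact hav _ (hagree.mono (le_max_right _ _)) _ (fun _ _ => rfl) r hr y hry (hl'T ▸ hy)

end NotReducible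

/-! ### Every problem is reducible to its completion -/

/-- Entry `i` of the decrement of the odd half of the word `w`, if there is one. -/
def oddEntry (w : List ℕ) (i : ℕ) : Option ℕ :=
  if i % 2 = 1 ∧ w.getD i 0 ≠ 0 then some (w.getD i 0 - 1) else none

/-- The word version of `decrement` applied to the second component of a pair. -/
def oddDecrement (w : List ℕ) : List ℕ := (List.range w.length).filterMap (oddEntry w)

theorem computable_oddDecrement : Computable oddDecrement := by
  have hget : Primrec₂ fun (w : List ℕ) (i : ℕ) => w.getD i 0 := Primrec.list_getD 0
  have hmod : Primrec₂ fun (_ : List ℕ) (i : ℕ) => i % 2 :=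
    Primrec.nat_mod.comp Primrec.snd (Primrec.const 2)
  have : Primrec₂ oddEntry := by
    refine Primrec.ite ?_ (Primrec.option_some.comp (Primrec.nat_sub.comp hget (Primrec.const 1)))
      (Primrec.const none)
    exact (Primrec.eq.comp hmod (Primrec.const 1)).and
      (Primrec.eq.comp hget (Primrec.const 0)).not
  exact (Primrec.listFilterMap (Primrec.list_range.comp Primrec.list_length) this).to_comp

theorem oddDecrement_prefix {u v : List ℕ} (h : u <+: v) : oddDecrement u <+: oddDecrement v := by
  obtain ⟨t, rfl⟩ := h
  have h1 : oddDecrement u = (List.range u.length).filterMap (oddEntry (u ++ t)) := by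
    refine List.filterMap_congr fun i hi => ?_
    have hi' := List.mem_range.1 hi
    simp [oddEntry, List.getElem?_append_left hi']
  rw [h1, oddDecrement, List.length_append, List.range_add, List.filterMap_append]
  exact List.prefix_append _ _

theorem getD_prefixWord {p : Baire} {n i : ℕ} (hi : i < n) : (prefixWord p n).getD i 0 = p i := by
  simp [prefixWord, hi]

theorem length_prefixWord (p : Baire) (n : ℕ) : (prefixWord p n).length = n := by
  simp [prefixWord]

theorem prefixWord_succ (p : Baire) (n : ℕ) : prefixWord p (n + 1) = prefixWord p n ++ [p n] := by
  simp [prefixWord, List.range_succ]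

theorem oddDecrement_prefixWord_pairing (p q : Baire) (m : ℕ) :
    oddDecrement (prefixWord (pairing p q) m) =
      prefixWord (decrement q) (Nat.count (fun i => q i ≠ 0) (m / 2)) := by
  have hcongr : ∀ m, oddDecrement (prefixWord (pairing p q) m) = (List.range m).filterMap fun i =>
      if i % 2 = 1 ∧ pairing p q i ≠ 0 then some (pairing p q i - 1) else none := by
    intro m
    rw [oddDecrement, length_prefixWord]
    refine List.filterMap_congr fun i hi => ?_
    rw [oddEntry, getD_prefixWord (List.mem_range.1 hi)]
  rw [hcongr]
  induction m with
  | zero => simp [prefixWord]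
  | succ m ih =>
    rw [List.range_succ, List.filterMap_append, ih]
    rcases Nat.mod_two_eq_zero_or_one m with h | h
    · have : (m + 1) / 2 = m / 2 := by omega
      simp [this, h]
    · have h2 : (m + 1) / 2 = m / 2 + 1 := by omega
      have h3 : pairing p q m = q (m / 2) := by simp [pairing, h]
      rw [h2, Nat.count_succ]
      by_cases h0 : q (m / 2) = 0
      · simp [h3, h0]
      · have h4 : decrement q (Nat.count (fun i => q i ≠ 0) (m / 2)) = q (m / 2) - 1 := by
          rw [decrement, Nat.nth_count (p := fun i => q i ≠ 0) h0]
        rw [if_pos h0, prefixWord_succ, h4]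
        simp [h3, h0, h]

theorem weihrauchLE_completion {X Y : Type*} (f : Problem X Y) : WeihrauchLE f f.completion := by
  let odd : Baire → Baire := fun s n => s (2 * n + 1)
  have hodd : ∀ p q, odd (pairing p q) = q := by
    intro p q
    funext n
    have h1 : (2 * n + 1) % 2 ≠ 0 := by omega
    have h2 : (2 * n + 1) / 2 = n := by omega
    simp only [odd, pairing, if_neg h1, h2]
  have hpair : ∀ s, pairing (fun n => s (2 * n)) (odd s) = s := by
    intro s
    funext n
    rcases Nat.mod_two_eq_zero_or_one n with h | h
    · simp only [pairing, h, if_true]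
      congr 1; omega
    · simp only [pairing, h, one_ne_zero, if_false, odd]
      congr 1; omega
  refine ⟨fun s => ⟨{i | odd s i ≠ 0}.Infinite, fun _ => decrement (odd s)⟩,
    fun p => Part.some fun n => p n + 1, ⟨oddDecrement, computable_oddDecrement,
      fun _ _ => oddDecrement_prefix, ?_⟩, ⟨List.map Nat.succ, ?_, fun _ _ h => h.map _, ?_⟩, ?_⟩
  · rintro s _ ⟨hinf, rfl⟩
    have key : ∀ m, oddDecrement (prefixWord s m) = prefixWord (decrement (odd s))
        (Nat.count (fun i => odd s i ≠ 0) (m / 2)) := by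
      intro m
      conv_lhs => rw [← hpair s]
      exact oddDecrement_prefixWord_pairing _ _ _
    refine ⟨fun m => by simp only [key, length_prefixWord], fun n =>
      ⟨2 * Nat.nth (fun i => odd s i ≠ 0) n, ?_⟩⟩
    rw [key, length_prefixWord, Nat.mul_div_cancel_left _ two_pos,
      Nat.count_nth_of_infinite (p := fun i => odd s i ≠ 0) hinf]
  · exact (Primrec.list_map Primrec.id (Primrec.succ.comp Primrec.snd).to₂).to_comp
  · intro p q hq
    obtain rfl := Part.mem_some_iff.1 hq
    exact ⟨fun m => by simp [prefixWord], fun n => ⟨n, by simp [prefixWord]⟩⟩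
  · intro G hG p x hp hx
    have hnames : f.completion.inRep.names (fun n => p n + 1) (some x) := by
      refine ⟨by simpa using Set.infinite_univ (α := ℕ), ?_⟩
      rw [decrement_succ]
      exact hp
    obtain ⟨q, hq, y, hy, hqy⟩ := hG _ _ hnames (f.mem_dom_completion _)
    obtain ⟨y', hy', rfl⟩ := hy x rfl hx
    refine ⟨decrement q, ?_, y', hy', hqy.2⟩
    simp only [sandwich, Part.bind_some, Part.mem_bind_iff]
    refine ⟨q, hq, ?_, ?_⟩
    · simpa only [hodd] using hqy.1
    · simp only [hodd]

/-! ### The unit interval -/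

theorem positiveConnectedChoice_realizes {X : Type*} [MetricSpace X] [MeasurableSpace X]
    {α : ℕ → X} {hα : DenseRange α} {μ : Measure X} {G : Baire →. Baire}
    (hG : Realizes G (positiveChoice α hα μ)) :
    Realizes G (positiveConnectedChoice α hα μ) := by
  rintro p A hp ⟨x, ⟨hA, hconn⟩, hx⟩
  obtain ⟨q, hq, y, ⟨-, hy⟩, hqy⟩ := hG p A hp ⟨x, hA, hx⟩
  exact ⟨q, hq, y, ⟨⟨hA, hconn⟩, hy⟩, hqy⟩

/-- Between any two nonnegative bounds there is a rational radius `r`, and the ball around `α n` with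
that radius is a basic ball. -/
theorem exists_basicBall_eq_ball {X : Type*} [MetricSpace X] (α : ℕ → X) (n : ℕ) {a b : ℝ}
    (ha : 0 ≤ a) (hab : a < b) :
    ∃ r, a < r ∧ r < b ∧ ∃ m, basicBall α m = Metric.ball (α n) r := by
  obtain ⟨r, har, hrb⟩ := exists_rat_btwn hab
  have hr : (0 : ℚ) < r := by exact_mod_cast ha.trans_lt har
  refine ⟨r, har, hrb, Nat.pair n (Nat.pair r.num.toNat (r.den - 1)), ?_⟩
  have h1 : ((r.num.toNat : ℕ) : ℝ) = (r.num : ℝ) := by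
    have := Int.toNat_of_nonneg (Rat.num_nonneg.2 hr.le)
    exact_mod_cast congrArg (Int.cast : ℤ → ℝ) this
  have h2 : ((r.den - 1 : ℕ) : ℝ) + 1 = r.den := by
    exact_mod_cast Nat.sub_add_cancel r.den_pos
  simp only [basicBall, Nat.unpair_pair, h1, h2]
  rw [Rat.cast_def]

/-- A basic ball removes from `[a, b]` a right end which contains the right half. -/
theorem exists_Icc_sdiff_basicBall_right {a b : unitInterval} (hab : a < b) :
    ∃ m, ∃ t : unitInterval, a < t ∧ (t : ℝ) < ((a : ℝ) + b) / 2 ∧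
      Set.Icc a b \ basicBall unitRat m = Set.Icc a t := by
  -- With `d = (b - a) / 8`, a center at distance less than `d` from the end of the interval and a
  -- radius between `5 * d` and `6 * d` put the new end point beyond the midpoint.
  have hab' : (a : ℝ) < b := hab
  obtain ⟨n, hn⟩ := denseRange_unitRat.exists_dist_lt b
    (show (0 : ℝ) < ((b : ℝ) - a) / 8 by linarith)
  obtain ⟨r, hr1, hr2, m, hm⟩ := exists_basicBall_eq_ball unitRat n
    (show (0 : ℝ) ≤ 5 * (((b : ℝ) - a) / 8) by linarith)
    (show 5 * (((b : ℝ) - a) / 8) < 6 * (((b : ℝ) - a) / 8) by linarith)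
  rw [Subtype.dist_eq, Real.dist_eq, abs_lt] at hn
  have ha0 := a.2.1
  have hb1 := b.2.2
  refine ⟨m, ⟨unitRat n - r, by constructor <;> linarith⟩, ?_, ?_, ?_⟩
  · rw [← Subtype.coe_lt_coe]; simp only; linarith
  · simp only; linarith
  · ext x
    rw [hm]
    simp only [Set.mem_sdiff, Set.mem_Icc, Metric.mem_ball, Subtype.dist_eq, Real.dist_eq, abs_lt,
      ← Subtype.coe_le_coe]
    constructor
    · rintro ⟨⟨h1, h2⟩, h3⟩
      refine ⟨h1, not_lt.1 fun h4 => h3 ⟨by linarith, by linarith⟩⟩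
    · rintro ⟨h1, h2⟩
      exact ⟨⟨h1, by linarith⟩, fun h3 => by linarith⟩

/-- A basic ball removes from `[a, b]` a left end which contains the left half. -/
theorem exists_Icc_sdiff_basicBall_left {a b : unitInterval} (hab : a < b) :
    ∃ m, ∃ t : unitInterval, t < b ∧ ((a : ℝ) + b) / 2 < t ∧
      Set.Icc a b \ basicBall unitRat m = Set.Icc t b := by
  -- With `d = (b - a) / 8`, a center at distance less than `d` from the end of the interval and a
  -- radius between `5 * d` and `6 * d` put the new end point beyond the midpoint.
  have hab' : (a : ℝ) < b := hab
  obtain ⟨n, hn⟩ := denseRange_unitRat.exists_dist_lt a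
    (show (0 : ℝ) < ((b : ℝ) - a) / 8 by linarith)
  obtain ⟨r, hr1, hr2, m, hm⟩ := exists_basicBall_eq_ball unitRat n
    (show (0 : ℝ) ≤ 5 * (((b : ℝ) - a) / 8) by linarith)
    (show 5 * (((b : ℝ) - a) / 8) < 6 * (((b : ℝ) - a) / 8) by linarith)
  rw [Subtype.dist_eq, Real.dist_eq, abs_lt] at hn
  have ha0 := a.2.1
  have hb1 := b.2.2
  refine ⟨m, ⟨unitRat n + r, by constructor <;> linarith⟩, ?_, ?_, ?_⟩
  · rw [← Subtype.coe_lt_coe]; simp only; linarith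
  · simp only; linarith
  · ext x
    rw [hm]
    simp only [Set.mem_sdiff, Set.mem_Icc, Metric.mem_ball, Subtype.dist_eq, Real.dist_eq, abs_lt,
      ← Subtype.coe_le_coe]
    constructor
    · rintro ⟨⟨h1, h2⟩, h3⟩
      refine ⟨not_lt.1 fun h4 => h3 ⟨by linarith, by linarith⟩, h2⟩
    · rintro ⟨h1, h2⟩
      exact ⟨⟨by linarith, h2⟩, fun h3 => by linarith⟩

theorem not_completion_PCCI_le_PCI : ¬ WeihrauchLE PCCI.completion PCI := by
  refine not_completion_choiceOn_le_positiveChoice unitRat denseRange_unitRat volume unitRat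
    denseRange_unitRat _ {C | ∃ a b : unitInterval, a < b ∧ C = Set.Icc a b}
    ⟨0, 1, zero_lt_one, Set.Icc_bot_top.symm⟩ ?_ ?_
  · rintro C ⟨a, b, hab, hC⟩
    refine ⟨⟨?_, ?_⟩, ?_⟩
    · rw [hC, unitInterval.volume_Icc]
      simpa using hab
    · rw [hC]; exact isConnected_Icc hab.le
    · rw [hC]; exact Set.nonempty_Icc.2 hab.le
  · rintro _ ⟨a, b, hab, rfl⟩
    obtain ⟨m, t, ht, htm, hm⟩ := exists_Icc_sdiff_basicBall_right hab
    obtain ⟨m', t', ht', htm', hm'⟩ := exists_Icc_sdiff_basicBall_left hab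
    refine ⟨m, m', ⟨a, t, ht, hm⟩, ⟨t', b, ht', hm'⟩, ?_⟩
    rw [hm, hm', Set.disjoint_left]
    intro x hx hx'
    have h1 : (x : ℝ) ≤ t := hx.2
    have h2 : (t' : ℝ) ≤ x := hx'.1
    linarith

/-! ### Cantor space -/

instance : BorelSpace Cantor := inferInstanceAs (BorelSpace (ℕ → Bool))

instance : IsProbabilityMeasure cantorMeasure :=
  inferInstanceAs (IsProbabilityMeasure (Measure.infinitePi _))

theorem dist_cantor_le_iff {x y : Cantor} {n : ℕ} :
    dist y x ≤ (1 / 2 : ℝ) ^ n ↔ ∀ i < n, y i = x i :=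
  (PiNat.mem_cylinder_iff_dist_le (E := fun _ : ℕ => Bool)).symm

theorem cantorMeasure_cylinder_pos (c : Cantor) (n : ℕ) :
    0 < cantorMeasure {x | ∀ i < n, x i = c i} := by
  have h : {x : Cantor | ∀ i < n, x i = c i} =
      Set.pi (Finset.range n) fun i => ({c i} : Set Bool) := by
    ext x; simp; rfl
  have h' : cantorMeasure {x | ∀ i < n, x i = c i} =
      ∏ i ∈ Finset.range n, (PMF.uniformOfFintype Bool).toMeasure {c i} :=
    (congrArg cantorMeasure h).trans
      (Measure.infinitePi_pi _ fun i _ => measurableSet_singleton _)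
  rw [h']
  refine pos_iff_ne_zero.2 (Finset.prod_ne_zero_iff.2 fun i _ => ?_)
  rw [PMF.toMeasure_apply_singleton _ _ (measurableSet_singleton _)]
  simp

/-- The sequence `c` with its digit at position `n` set to `v`. -/
def setDigit (c : Cantor) (n : ℕ) (v : Bool) : Cantor := fun i => if i = n then v else c i

theorem setDigit_self (c : Cantor) (n : ℕ) (v : Bool) : setDigit c n v n = v := if_pos rfl

theorem setDigit_of_ne (c : Cantor) (v : Bool) {n i : ℕ} (h : i ≠ n) : setDigit c n v i = c i :=
  if_neg h

/-- Removing from a cylinder the half with next digit `v`, which is a basic ball, leaves the other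
half. -/
theorem exists_cylinder_sdiff_basicBall (c : Cantor) (n : ℕ) (v : Bool) :
    ∃ m, {x : Cantor | ∀ i < n, x i = c i} \ basicBall cantorDense m =
      {x | ∀ i < n + 1, x i = setDigit c n (!v) i} := by
  obtain ⟨k, hk⟩ := denseRange_cantorDense.exists_dist_lt (setDigit c n v)
    (show (0 : ℝ) < (1 / 2 : ℝ) ^ (n + 1) by positivity)
  have hk' := dist_cantor_le_iff.1 hk.le
  obtain ⟨r, hr1, hr2, m, hm⟩ := exists_basicBall_eq_ball cantorDense k
    (show (0 : ℝ) ≤ (1 / 2 : ℝ) ^ (n + 1) by positivity)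
    (show (1 / 2 : ℝ) ^ (n + 1) < (1 / 2 : ℝ) ^ n from
      pow_lt_pow_right_of_lt_one₀ (by norm_num) (by norm_num) n.lt_succ_self)
  have hkn : cantorDense k n = v := by rw [← hk' n n.lt_succ_self, setDigit_self]
  refine ⟨m, ?_⟩
  rw [hm]
  ext x
  simp only [Set.mem_sdiff, Set.mem_ofPred_eq, Metric.mem_ball]
  constructor
  · rintro ⟨hx, hxr⟩ i hi
    rcases Nat.lt_succ_iff_lt_or_eq.1 hi with hin | rfl
    · rw [setDigit_of_ne _ _ hin.ne, hx i hin]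
    · rw [setDigit_self, Bool.eq_not]
      rintro rfl
      refine hxr (lt_of_le_of_lt (dist_cantor_le_iff.2 fun j hj => ?_) hr1)
      rw [← hk' j hj]
      rcases Nat.lt_succ_iff_lt_or_eq.1 hj with hji | rfl
      · rw [setDigit_of_ne _ _ hji.ne, hx j hji]
      · rw [setDigit_self]
  · intro hx
    refine ⟨fun i hi => ?_, fun hxr => ?_⟩
    · rw [hx i (hi.trans n.lt_succ_self), setDigit_of_ne _ _ hi.ne]
    · have h1 : x n = cantorDense k n :=
        PiNat.apply_eq_of_dist_lt (E := fun _ : ℕ => Bool) (hxr.trans hr2) le_rfl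
      have h2 := hx n n.lt_succ_self
      rw [setDigit_self, h1, hkn] at h2
      simp at h2

theorem not_completion_PCCantor_le : ¬ WeihrauchLE PCCantor.completion PCCantor := by
  refine not_completion_choiceOn_le_positiveChoice cantorDense denseRange_cantorDense cantorMeasure
    cantorDense denseRange_cantorDense _
    {C | ∃ (c : Cantor) (n : ℕ), C = {x | ∀ i < n, x i = c i}}
    ⟨fun _ => false, 0, by simp⟩ ?_ ?_
  · rintro C ⟨c, n, hC⟩
    refine ⟨?_, ?_⟩
    · change 0 < cantorMeasure (C : Set Cantor)
      rw [hC]; exact cantorMeasure_cylinder_pos c n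
    · rw [hC]; exact ⟨c, fun _ _ => rfl⟩
  · rintro _ ⟨c, n, rfl⟩
    obtain ⟨m, hm⟩ := exists_cylinder_sdiff_basicBall c n false
    obtain ⟨m', hm'⟩ := exists_cylinder_sdiff_basicBall c n true
    refine ⟨m, m', ⟨_, _, hm⟩, ⟨_, _, hm'⟩, ?_⟩
    rw [hm, hm', Set.disjoint_left]
    intro x hx hx'
    have h1 := hx n n.lt_succ_self
    have h2 := hx' n n.lt_succ_self
    rw [setDigit_self] at h1 h2
    simp [h1] at h2

end WeihrauchChoice

theorem proposition7p2 :
    ¬ WeihrauchChoice.WeihrauchLE WeihrauchChoice.PCCI.completion WeihrauchChoice.PCI ∧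
    WeihrauchChoice.WeihrauchLT WeihrauchChoice.PCCantor WeihrauchChoice.PCCantor.completion ∧
    WeihrauchChoice.WeihrauchLT WeihrauchChoice.PCCI WeihrauchChoice.PCCI.completion := by
  refine ⟨WeihrauchChoice.not_completion_PCCI_le_PCI,
    ⟨WeihrauchChoice.weihrauchLE_completion _, WeihrauchChoice.not_completion_PCCantor_le⟩,
    WeihrauchChoice.weihrauchLE_completion _, ?_⟩
  rintro ⟨H, K, hH, hK, h⟩
  exact WeihrauchChoice.not_completion_PCCI_le_PCI ⟨H, K, hH, hK, fun G hG =>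
    h G (WeihrauchChoice.positiveConnectedChoice_realizes hG)⟩
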